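/- **Model.** Let $G=(V,E)$ be a finite connected graph with $|V|\ge 2$ whose vertices are processes; $\mathcal N_p$ is the set of neighbors of $p$. Let $\varrho\ge 1$ be an integer. For $i\in\{1,2\}$ let $\alpha_i,K_i\ge 1$ be integers, $\chi_i=\{-\alpha_i,\dots,0,\dots,K_i-1\}$, and $\varphi_i:\chi_i\to\chi_i$, $\varphi_i(x)=(x+1)\bmod K_i$ if $x\ge 0$ and $\varphi_i(x)=x+1$ if $x<0$. Put $\mathrm{tail}_i=\{-\alpha_i,\dots,0\}$, $\mathrm{tail}_i^*=\mathrm{tail}_i\setminus\{0\}$, $\mathrm{ring}_i=\{0,\dots,K_i-1\}$, and let $d_{K_i}(a,b)=\min((a-b)\bmod K_i,(b-a)\bmod K_i)$. Assume $\alpha_i\ge T_G$ and $K_i> C_G$ for $i=1,2$, where $T_G$ is the length of a longest chordless cycle of $G$, and $C_G$ is the minimum, over all cycle bases of $G$, of the length of the longest cycle in the basis (a cycle basis is a set of simple cycles that forms a basis of the cycle space over $\mathbb F_2$); $T_G=C_G=2$ if $G$ is acyclic. **Algorithm SS-DC.** Each process $p$ holds a master clock $p.r_1\in\chi_1$, a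 slave clock $p.r_2\in\chi_2$, and arbitrary auxiliary registers. For $i\in\{1,2\}$ define - $\mathrm{ConvergenceStep}^i_p$: $p.r_i\in\mathrm{tail}_i^*$ and, for all $q\in\mathcal N_p$, $q.r_i\in\mathrm{tail}_i$ and $p.r_i\le q.r_i$; - $\mathrm{LocallyCorrect}^i_p$: $p.r_i\in\mathrm{ring}_i$ and, for all $q\in\mathcal N_p$, $q.r_i\in\mathrm{ring}_i$ and ($p.r_i=q.r_i$ or $p.r_i=\varphi_i(q.r_i)$ or $\varphi_i(p.r_i)=q.r_i$); - $\mathrm{NormalStep}^i_p$: $p.r_i\in\mathrm{ring}_i$ and, for all $q\in\mathcal N_p$, $q.r_i=p.r_i$ or $q.r_i=\varphi_i(p.r_i)$; - $\mathrm{ResetInit}^i_p$: not $\mathrm{LocallyCorrect}^i_p$, and $p.r_i\notin\mathrm{tail}_i$. The guarded actions of $p$ are, for $i\in\{1,2\}$, $$CA_i:\ \mathrm{ConvergenceStep}^i_p\to p.r_i:=\varphi_i(p.r_i),\qquad RA_i:\ \mathrm{ResetInit}^i_p\to p.r_i:=-\alpha_i,$$ and $NA$, with guard $\mathrm{NormalStep}^1_p\wedge\mathrm{LocallyCorrect}^2_p$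 and the following statement. If $p.r_1\equiv\varrho-1 \pmod{\varrho}$: first, if $\mathrm{NormalStep}^2_p\wedge cond$ holds, execute $CS2$ and then, if $cond_1$ holds, set $p.r_2:=\varphi_2(p.r_2)$; next execute $Initialization$. If $p.r_1\not\equiv\varrho-1\pmod\varrho$: execute $Computation$. In both cases finally set $p.r_1:=\varphi_1(p.r_1)$. Here $cond,cond_1$ are arbitrary predicates, and $CS2$, $Initialization$, $Computation$ arbitrary procedures that write only auxiliary registers of $p$; all of them read only registers of $p$ and of its neighbors, and $cond$ does not depend on $p.r_1$. **Executions.** In a step $\gamma\mapsto\gamma'$, the daemon chooses a nonempty set of enabled processes (processes with an action whose guard is true in $\gamma$); each chosen process atomically executes one of its enabled actions. No fairness is assumed (unfair distributed daemon). An execution is a finite or infinite sequence of configurations linked by steps; it is maximal if it is infinite or ends in a configuration where no process is enabled. Let $WU_i$ be the set of configurations in which, for all $p\in V$ and $q\in\mathcal N_p$, $p.r_i\in\mathrm{ring}_i$ and $d_{K_i}(p.r_i,q.r_i)\le1$; let $WU=WU_1\cap WU_2$. **Proposition.** Algorithm SS-DC is self-stabilizing to $WU$ under the unfair distributed daemon: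 every configuration of every execution that starts in $WU$ belongs to $WU$, and every maximal execution, from any initial configuration, contains a configuration in $WU$. -/

import Mathlib

namespace LayerClock

/-! ### Executions and self-stabilization -/

section Executions

variable {Γ : Type*}

/-- An execution of the transition graph `(Γ, T)`: a finite or infinite sequence of configurations
`state 0, state 1, …, state last` (`last = ⊤`: infinite) whose successive members are linked by
transitions. The values of `state` beyond `last` carry no meaning. -/
structure Execution (T : Γ → Γ → Prop) where
  state : ℕ → Γ
  last : ℕ∞
  step : ∀ i : ℕ, (i : ℕ∞) < last → T (state i) (state (i + 1))

/-- An execution is maximal if it is infinite or ends in a configuration without successor. -/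
def Execution.IsMaximal {T : Γ → Γ → Prop} (e : Execution T) : Prop :=
  ∀ i : ℕ, e.last = (i : ℕ∞) → ∀ γ : Γ, ¬ T (e.state i) γ

/-- `P` is closed: every configuration of an execution that starts in `P` satisfies `P`. -/
def Closed (T : Γ → Γ → Prop) (P : Γ → Prop) : Prop :=
  ∀ e : Execution T, P (e.state 0) → ∀ i : ℕ, (i : ℕ∞) ≤ e.last → P (e.state i)

/-- `P ▷ Q`: `Q` is closed, and every maximal execution that starts in `P` contains a
configuration that satisfies `Q`. -/
def Attractor (T : Γ → Γ → Prop) (P Q : Γ → Prop) : Prop :=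
  Closed T Q ∧
    ∀ e : Execution T, e.IsMaximal → P (e.state 0) →
      ∃ i : ℕ, (i : ℕ∞) ≤ e.last ∧ Q (e.state i)

/-- `T` is self-stabilizing for `P`, i.e. `true ▷ P`. -/
def SelfStabilizing (T : Γ → Γ → Prop) (P : Γ → Prop) : Prop :=
  Attractor T (fun _ => True) P

end Executions

/-! ### The two graph constants -/

section GraphConstants

variable {V : Type*} (G : SimpleGraph V)

open Classical in
/-- `T_G`: the length of a longest chordless cycle, and `2` if the graph is acyclic. (On a finite
graph the set of lengths is bounded, and it is nonempty if the graph has a cycle.) -/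
noncomputable def greatestHole : ℕ :=
  if G.IsAcyclic then 2
  else sSup {ℓ : ℕ | ∃ (v : V) (c : G.Walk v v), c.IsCycle ∧ c.IsChordless ∧ c.length = ℓ}

/-- `s` is the edge set of a (simple) cycle of `G`. -/
def IsCycleEdgeSet (s : Finset (Sym2 V)) : Prop :=
  ∃ (v : V) (c : G.Walk v v), c.IsCycle ∧ ∀ e : Sym2 V, e ∈ s ↔ e ∈ c.edges

open Classical in
/-- The characteristic vector over `𝔽₂` of a set of edges. -/
noncomputable def edgeVector (s : Finset (Sym2 V)) : Sym2 V → ZMod 2 :=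
  fun e => if e ∈ s then 1 else 0

/-- The cycle space of `G`: the `𝔽₂`-vector space generated by the cycles of `G`. -/
noncomputable def cycleSpace : Submodule (ZMod 2) (Sym2 V → ZMod 2) :=
  Submodule.span (ZMod 2) (edgeVector '' {s | IsCycleEdgeSet G s})

/-- `B` is a cycle basis of `G`: a set of cycles whose characteristic vectors form a basis of the
cycle space. -/
def IsCycleBasis (B : Finset (Finset (Sym2 V))) : Prop :=
  (∀ s ∈ B, IsCycleEdgeSet G s) ∧
    LinearIndependent (ZMod 2) (fun s : B => edgeVector s.1) ∧
    Submodule.span (ZMod 2) (edgeVector '' (B : Set (Finset (Sym2 V)))) = cycleSpace G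

open Classical in
/-- `C_G`, the cyclomatic characteristic: the least length, over all cycle bases, of the longest
cycle of the basis, and `2` if the graph is acyclic. -/
noncomputable def cyclomaticCharacteristic : ℕ :=
  if G.IsAcyclic then 2
  else sInf {ℓ : ℕ | ∃ B : Finset (Finset (Sym2 V)), IsCycleBasis G B ∧ B.sup Finset.card = ℓ}

end GraphConstants

/-! ### Finite incrementing systems -/

/-- The parameters of a finite incrementing system: the number `α` of extra values and the
period `K`. -/
structure IncrSystem where
  α : ℕ
  K : ℕ
  α_pos : 0 < α
  K_pos : 0 < K

namespace IncrSystem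

/-- The set of values `χ = {-α, …, 0, …, K - 1}`. -/
def Value (χ : IncrSystem) : Type :=
  {x : ℤ // -(χ.α : ℤ) ≤ x ∧ x < (χ.K : ℤ)}

variable {χ : IncrSystem}

/-- The incrementing function: `φ x = (x + 1) mod K` if `0 ≤ x`, and `φ x = x + 1` otherwise. -/
def φ (x : χ.Value) : χ.Value :=
  ⟨if 0 ≤ x.1 then (x.1 + 1) % (χ.K : ℤ) else x.1 + 1, by
    obtain ⟨x, h₁, h₂⟩ := x
    have hK : (0 : ℤ) < (χ.K : ℤ) := by exact_mod_cast χ.K_pos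
    dsimp only
    split_ifs with h
    · have h₃ := Int.emod_nonneg (x + 1) hK.ne'
      have h₄ := Int.emod_lt_of_pos (x + 1) hK
      omega
    · omega⟩

/-- The value `-α`, to which a reset leads. -/
def resetValue (χ : IncrSystem) : χ.Value :=
  ⟨-(χ.α : ℤ), by have := χ.K_pos; omega⟩

/-- `tail_φ = {-α, …, 0}`. -/
def InTail (x : χ.Value) : Prop := x.1 ≤ 0

/-- `tail_φ^* = {-α, …, -1}`. -/
def InTailStar (x : χ.Value) : Prop := x.1 < 0

/-- `ring_φ = {0, …, K - 1}`. -/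
def InRing (x : χ.Value) : Prop := 0 ≤ x.1

/-- The circular distance `d_K(x, y) = min ((x - y) mod K) ((y - x) mod K)`. -/
def circDist (x y : χ.Value) : ℤ :=
  min ((x.1 - y.1) % (χ.K : ℤ)) ((y.1 - x.1) % (χ.K : ℤ))

end IncrSystem

open IncrSystem

/-! ### The predicates on one clock -/

section OneClock

variable {V : Type*} (G : SimpleGraph V) {χ : IncrSystem} (r : V → χ.Value) (p : V)

def ConvergenceStep : Prop :=
  InTailStar (r p) ∧ ∀ q, G.Adj p q → InTail (r q) ∧ (r p).1 ≤ (r q).1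

def LocallyCorrect : Prop :=
  InRing (r p) ∧
    ∀ q, G.Adj p q → InRing (r q) ∧ (r p = r q ∨ r p = φ (r q) ∨ φ (r p) = r q)

def NormalStep : Prop :=
  InRing (r p) ∧ ∀ q, G.Adj p q → r p = r q ∨ r q = φ (r p)

def ResetInit : Prop :=
  ¬ LocallyCorrect G r p ∧ ¬ InTail (r p)

/-- All clock values are ring values, and those of neighbors differ by at most one on the ring. -/
def UnisonPred : Prop :=
  ∀ p q, G.Adj p q → InRing (r p) ∧ circDist (r p) (r q) ≤ 1

end OneClock

/-! ### The two-layer clock -/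

/-- The state of a process: its master clock `r₁`, its slave clock `r₂`, and the content `aux` of
all the other registers that the application uses. -/
structure ProcState (χ₁ χ₂ : IncrSystem) (A : Type*) where
  r₁ : χ₁.Value
  r₂ : χ₂.Value
  aux : A

/-- A configuration of the system. -/
abbrev Config (V : Type*) (χ₁ χ₂ : IncrSystem) (A : Type*) := V → ProcState χ₁ χ₂ A

/-- What the states of the neighbors of `p` may be. -/
abbrev NbrStates {V : Type*} (G : SimpleGraph V) (χ₁ χ₂ : IncrSystem) (A : Type*) (p : V) :=
  G.neighborSet p → ProcState χ₁ χ₂ A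

/-- The problem-dependent part of the algorithm, which is arbitrary: the predicate `cond`, which
does not depend on the register `r₁` of the process itself, the predicate `cond₁`, and the
procedures `CS2`, `Initialization` and `Computation`. All of them read the registers of the process
and of its neighbors; the procedures write the auxiliary registers of the process. -/
structure Application {V : Type*} (G : SimpleGraph V) (χ₁ χ₂ : IncrSystem) (A : Type*) where
  cond : (p : V) → χ₂.Value → A → NbrStates G χ₁ χ₂ A p → Prop
  cond₁ : (p : V) → ProcState χ₁ χ₂ A → NbrStates G χ₁ χ₂ A p → Prop
  criticalSection₂ : (p : V) → ProcState χ₁ χ₂ A → NbrStates G χ₁ χ₂ A p → A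
  initialization : (p : V) → ProcState χ₁ χ₂ A → NbrStates G χ₁ χ₂ A p → A
  computation : (p : V) → ProcState χ₁ χ₂ A → NbrStates G χ₁ χ₂ A p → A

/-- The labels of the guarded actions. -/
inductive Action
  | NA
  | CA₁
  | CA₂
  | RA₁
  | RA₂

section Protocol

variable {V : Type*} {G : SimpleGraph V} {χ₁ χ₂ : IncrSystem} {A : Type*}

/-- The guards of the actions of process `p`. -/
def Guard (G : SimpleGraph V) (γ : Config V χ₁ χ₂ A) (p : V) : Action → Prop
  | .NA => NormalStep G (fun q => (γ q).r₁) p ∧ LocallyCorrect G (fun q => (γ q).r₂) p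
  | .CA₁ => ConvergenceStep G (fun q => (γ q).r₁) p
  | .CA₂ => ConvergenceStep G (fun q => (γ q).r₂) p
  | .RA₁ => ResetInit G (fun q => (γ q).r₁) p
  | .RA₂ => ResetInit G (fun q => (γ q).r₂) p

/-- The states of the neighbors of `p` in `γ`. -/
def nbrs (G : SimpleGraph V) (γ : Config V χ₁ χ₂ A) (p : V) : NbrStates G χ₁ χ₂ A p :=
  fun q => γ q.1

open Classical in
/-- The state of `p` after the guarded command
`NormalStep² ∧ cond → CS2; if cond₁ then r₂ := φ₂ r₂` of action `NA`. -/
noncomputable def slaveStep (app : Application G χ₁ χ₂ A) (γ : Config V χ₁ χ₂ A) (p : V) :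
    ProcState χ₁ χ₂ A :=
  if NormalStep G (fun q => (γ q).r₂) p ∧ app.cond p (γ p).r₂ (γ p).aux (nbrs G γ p) then
    let s : ProcState χ₁ χ₂ A :=
      { γ p with aux := app.criticalSection₂ p (γ p) (nbrs G γ p) }
    if app.cond₁ p s (nbrs G γ p) then { s with r₂ := φ s.r₂ } else s
  else γ p

open Classical in
/-- The state of `p` after the statement of action `NA`. -/
noncomputable def normalAction (ρ : ℕ) (app : Application G χ₁ χ₂ A)
    (γ : Config V χ₁ χ₂ A) (p : V) : ProcState χ₁ χ₂ A :=
  let s : ProcState χ₁ χ₂ A :=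
    if (γ p).r₁.1 ≡ (ρ : ℤ) - 1 [ZMOD (ρ : ℤ)] then
      { slaveStep app γ p with
        aux := app.initialization p (slaveStep app γ p) (nbrs G γ p) }
    else { γ p with aux := app.computation p (γ p) (nbrs G γ p) }
  { s with r₁ := φ s.r₁ }

/-- The state of `p` after it has executed the statement of an action in `γ`. -/
noncomputable def exec (ρ : ℕ) (app : Application G χ₁ χ₂ A) (γ : Config V χ₁ χ₂ A) (p : V) :
    Action → ProcState χ₁ χ₂ A
  | .NA => normalAction ρ app γ p
  | .CA₁ => { γ p with r₁ := φ (γ p).r₁ }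
  | .CA₂ => { γ p with r₂ := φ (γ p).r₂ }
  | .RA₁ => { γ p with r₁ := resetValue χ₁ }
  | .RA₂ => { γ p with r₂ := resetValue χ₂ }

/-- The transitions of the algorithm under the unfair distributed daemon: the daemon chooses a
nonempty set of enabled processes (those with `σ p ≠ none`), and each of them atomically executes
one of its enabled actions. There is no fairness requirement. -/
def Step (ρ : ℕ) (app : Application G χ₁ χ₂ A) (γ γ' : Config V χ₁ χ₂ A) : Prop :=
  ∃ σ : V → Option Action,
    (∃ p a, σ p = some a) ∧
    (∀ p a, σ p = some a → Guard G γ p a ∧ γ' p = exec ρ app γ p a) ∧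
    (∀ p, σ p = none → γ' p = γ p)

/-- `WU₁`: the master clock is in unison. -/
def WU₁ (G : SimpleGraph V) (γ : Config V χ₁ χ₂ A) : Prop :=
  UnisonPred G (fun p => (γ p).r₁)

/-- `WU₂`: the slave clock is in unison. -/
def WU₂ (G : SimpleGraph V) (γ : Config V χ₁ χ₂ A) : Prop :=
  UnisonPred G (fun p => (γ p).r₂)

/-- `WU = WU₁ ∩ WU₂`. -/
def WU (G : SimpleGraph V) (γ : Config V χ₁ χ₂ A) : Prop :=
  WU₁ G γ ∧ WU₂ G γ

end Protocol

end LayerClock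

namespace LayerClock
open IncrSystem

/-! ### Cycles and the two graph constants -/

section GraphLemmas

variable {V : Type*} {G : SimpleGraph V}

/-! Each clock separately obeys the abstract dynamics `ClockStep`: a vertex stays, increments by a
normal or convergence step, or resets. A correct edge stays correct while both endpoints keep ring
values (`EdgeCorrect.step`), and in unison no vertex can reset; hence closure. A configuration where
nothing is enabled is in unison, since a vertex of minimal negative value could otherwise converge
(`unisonPred_of_disabled`). It remains to treat infinite executions.

The core is that resets are finite in number. A reset is either the first of its vertex or caused by
an earlier reset of a neighbor, which has stayed negative since while the vertex was positive
(`IsReset.exists_cause`). Along a chain of causes a vertex gains at most one per further link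
(`IsResetChain.val_le`), so it stays negative for `α` links. A shortest chain therefore has no
repetition and no chord at short range; if it had at least `|V|` links, a closest pair of adjacent
non-consecutive members would close a chordless cycle longer than `α`, against `greatestHole G ≤ α`.
So chain depth is below `|V|`, and each depth contains finitely many resets.

Without resets, negative values only increase, so convergence steps die out as well and only `NA`
moves remain. Some process makes infinitely many of them; since `K₁ ≥ 3`, a motionless neighbor
would block it, so by connectedness every process does. The guard of `NA` certifies all incident
edges on both clocks, and this persists (`exists_WU_of_infinite`). -/

theorem exists_walk_of_sequence (g : ℕ → V) (n : ℕ) (hadj : ∀ k < n, G.Adj (g k) (g (k + 1))) :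
    ∃ w : G.Walk (g 0) (g n), w.support = (List.range (n + 1)).map g ∧
      w.edges = (List.range n).map (fun k => s(g k, g (k + 1))) := by
  induction n with
  | zero => exact ⟨.nil, by simp, by simp⟩
  | succ n ih =>
    obtain ⟨w, hs, he⟩ := ih fun k hk => hadj k (by omega)
    refine ⟨w.concat (hadj n (by omega)), ?_, ?_⟩
    · rw [SimpleGraph.Walk.support_concat, hs, List.range_succ (n := n + 1)]
      simp
    · rw [SimpleGraph.Walk.edges_concat, he, List.range_succ (n := n)]
      simp

theorem length_le_greatestHole [Fintype V] {v : V} {c : G.Walk v v} (hc : c.IsCycle)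
    (hch : c.IsChordless) : c.length ≤ greatestHole G := by
  classical
  have hcyc : ¬ G.IsAcyclic := fun h => h c hc
  rw [greatestHole, if_neg hcyc]
  -- A supremum in `ℕ` is meaningful only for a bounded set: a cycle has at most `|V|` distinct
  -- vertices.
  refine le_csSup ⟨Fintype.card V, ?_⟩ ⟨v, c, hc, hch, rfl⟩
  rintro ℓ ⟨v, c, hc, -, rfl⟩
  have := hc.support_nodup.length_le_card
  simpa using this

/-- A closed sequence of distinct vertices without chords is at most as long as the longest
chordless cycle. -/
theorem succ_le_greatestHole [Fintype V] (g : ℕ → V) (n : ℕ) (hn : 2 ≤ n)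
    (hadj : ∀ k < n, G.Adj (g k) (g (k + 1))) (hclose : G.Adj (g n) (g 0))
    (hinj : ∀ i j, i < j → j ≤ n → g i ≠ g j)
    (hchord : ∀ i j, i + 2 ≤ j → j ≤ n → G.Adj (g i) (g j) → i = 0 ∧ j = n) :
    n + 1 ≤ greatestHole G := by
  obtain ⟨w, hs, he⟩ := exists_walk_of_sequence g n hadj
  have hinj' : ∀ i j, i ≤ n → j ≤ n → g i = g j → i = j := fun i j hi hj h => by
    rcases lt_trichotomy i j with hij | hij | hij
    · exact absurd h (hinj i j hij hj)
    · exact hij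
    · exact absurd h.symm (hinj j i hij hi)
  have hlen : w.length = n := by
    have := congrArg List.length hs
    simpa using this
  have hpath : w.IsPath := by
    rw [SimpleGraph.Walk.isPath_def, hs]
    refine List.Nodup.map_on ?_ List.nodup_range
    intro i hi j hj h
    rw [List.mem_range] at hi hj
    exact hinj' i j (by omega) (by omega) h
  -- By injectivity the closing edge could lie on the path only if `n = 1`.
  have hnot : s(g n, g 0) ∉ w.edges := by
    rw [he, List.mem_map]
    rintro ⟨k, hk, h⟩
    rw [List.mem_range] at hk
    rcases Sym2.eq_iff.1 h with ⟨h₁, h₂⟩ | ⟨h₁, h₂⟩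
    · have := hinj' _ _ (by omega) le_rfl h₁
      omega
    · have := hinj' _ _ (by omega) (by omega) h₁
      have := hinj' _ _ (by omega) le_rfl h₂
      omega
  have hcycle : (SimpleGraph.Walk.cons hclose w).IsCycle :=
    (SimpleGraph.Walk.cons_isCycle_iff w hclose).2 ⟨hpath, hnot⟩
  have hmem : ∀ u, u ∈ (SimpleGraph.Walk.cons hclose w).support → ∃ i ≤ n, g i = u := by
    intro u hu
    rw [SimpleGraph.Walk.support_cons, hs, List.mem_cons, List.mem_map] at hu
    rcases hu with rfl | ⟨i, hi, rfl⟩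
    · exact ⟨n, le_rfl, rfl⟩
    · exact ⟨i, by rw [List.mem_range] at hi; omega, rfl⟩
  have hedge : ∀ i j, i < j → j ≤ n → G.Adj (g i) (g j) →
      s(g i, g j) ∈ (SimpleGraph.Walk.cons hclose w).edges := by
    intro i j hij hj h
    rw [SimpleGraph.Walk.edges_cons, List.mem_cons]
    rcases Nat.lt_or_ge j (i + 2) with hlt | hge
    · right
      obtain rfl : j = i + 1 := by omega
      rw [he, List.mem_map]
      exact ⟨i, by rw [List.mem_range]; omega, rfl⟩
    · left
      obtain ⟨rfl, rfl⟩ := hchord i j hge hj h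
      exact Sym2.eq_swap
  have hchordless : (SimpleGraph.Walk.cons hclose w).IsChordless := by
    rw [SimpleGraph.Walk.isChordless_iff_forall_mem_edges]
    intro u v hu hv huv
    obtain ⟨i, hi, rfl⟩ := hmem u hu
    obtain ⟨j, hj, rfl⟩ := hmem v hv
    rcases lt_trichotomy i j with hij | rfl | hij
    · exact hedge i j hij hj huv
    · exact absurd huv G.irrefl
    · rw [Sym2.eq_swap]
      exact hedge j i hij hi huv.symm
  have := length_le_greatestHole hcycle hchordless
  rwa [SimpleGraph.Walk.length_cons, hlen] at this

/-- A walk that never returns within `a` steps to a neighbor, nor within `a + 1` steps to a vertex,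
of one of its vertices, where `a` is at least the length of the longest chordless cycle,
has fewer steps than the graph has vertices. -/
theorem length_lt_card_of_no_short_return [Fintype V] {a : ℕ} (ha : 0 < a)
    (haG : greatestHole G ≤ a) (g : ℕ → V) (n : ℕ)
    (hadj : ∀ k < n, G.Adj (g k) (g (k + 1)))
    (hne : ∀ i j, i < j → j ≤ n → j ≤ i + a + 1 → g i ≠ g j)
    (hnadj : ∀ i j, i + 2 ≤ j → j ≤ n → j ≤ i + a → ¬ G.Adj (g i) (g j)) :
    n < Fintype.card V := by
  classical
  by_contra hcard
  have key : ∀ i j, i < j → j ≤ n → g i = g j → i + 3 ≤ j ∧ G.Adj (g i) (g (j - 1)) := by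
    intro i j hij hj h
    have h1 : ¬ j ≤ i + a + 1 := fun h' => hne i j hij hj h' h
    refine ⟨by omega, ?_⟩
    have h2 := hadj (j - 1) (by omega)
    rw [Nat.sub_add_cancel (by omega), ← h] at h2
    exact h2.symm
  -- If `n ≥ |V|`, some vertex repeats, and the predecessor of its second occurrence is adjacent to
  -- the first. The least such gap `d` yields the chordless cycle: a repetition or another chord
  -- inside the window would give a smaller gap.
  have hex : ∃ d, 2 ≤ d ∧ ∃ i, i + d ≤ n ∧ G.Adj (g i) (g (i + d)) := by
    obtain ⟨x, y, hxy, h⟩ := Fintype.exists_ne_map_eq_of_card_lt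
      (fun x : Fin (n + 1) => g x) (by rw [Fintype.card_fin]; omega)
    have hx := x.2
    have hy := y.2
    have hxy' : (x : ℕ) ≠ y := fun h => hxy (Fin.ext h)
    rcases lt_or_gt_of_ne hxy' with hlt | hlt
    · obtain ⟨h1, h2⟩ := key x y hlt (by omega) h
      exact ⟨y - 1 - x, by omega, x, by omega, by
        rwa [show (x : ℕ) + (y - 1 - x) = y - 1 by omega]⟩
    · obtain ⟨h1, h2⟩ := key y x hlt (by omega) h.symm
      exact ⟨x - 1 - y, by omega, y, by omega, by
        rwa [show (y : ℕ) + (x - 1 - y) = x - 1 by omega]⟩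
  obtain ⟨hd, i, hid, hadj_d⟩ := Nat.find_spec hex
  have hmin : ∀ k l, k + 2 ≤ l → l ≤ n → G.Adj (g k) (g l) → Nat.find hex ≤ l - k := by
    intro k l hkl hl h
    exact Nat.find_min' hex ⟨by omega, k, by omega, by rwa [Nat.add_sub_cancel' (by omega)]⟩
  set d := Nat.find hex
  have hda : ¬ i + d ≤ i + a := fun h => hnadj i (i + d) (by omega) hid h hadj_d
  have := succ_le_greatestHole (G := G) (fun k => g (i + k)) d hd
    (fun k hk => hadj (i + k) (by omega)) hadj_d.symm
    (fun k l hkl hl h => by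
      obtain ⟨h1, h2⟩ := key (i + k) (i + l) (by omega) (by omega) h
      have := hmin _ _ (by omega) (by omega) h2
      omega)
    (fun k l hkl hl h => by
      have := hmin _ _ (by omega) (by omega) h
      omega)
  omega

theorem card_le_of_isCycleEdgeSet {s : Finset (Sym2 V)} (hs : IsCycleEdgeSet G s) :
    3 ≤ s.card := by
  classical
  obtain ⟨v, c, hc, h⟩ := hs
  obtain rfl : s = c.edges.toFinset := by
    ext e
    rw [h, List.mem_toFinset]
  rw [List.toFinset_card_of_nodup hc.edges_nodup, SimpleGraph.Walk.length_edges]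
  exact hc.three_le_length

theorem edgeVector_injective : Function.Injective (edgeVector (V := V)) := by
  classical
  intro s t h
  ext e
  have := congrFun h e
  unfold edgeVector at this
  by_cases h₁ : e ∈ s <;> by_cases h₂ : e ∈ t <;> simp_all

/-- Ensures that the infimum defining `cyclomaticCharacteristic` is not the default value `0` of an
empty set. A basis is extracted from the spanning family of cycle vectors and pulled back along the
injective `edgeVector`. -/
theorem exists_isCycleBasis [Fintype V] : ∃ B, IsCycleBasis G B := by
  classical
  obtain ⟨b, hb, hspan, hli⟩ := exists_linearIndependent (ZMod 2)
    (edgeVector '' {s | IsCycleEdgeSet G s})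
  have himg : edgeVector '' {s : Finset (Sym2 V) | edgeVector s ∈ b} = b := by
    ext x
    refine ⟨?_, fun hx => ?_⟩
    · rintro ⟨s, hs, rfl⟩
      exact hs
    · obtain ⟨s, -, rfl⟩ := hb hx
      exact ⟨s, hx, rfl⟩
  obtain ⟨B, hB⟩ : ∃ B : Finset (Finset (Sym2 V)), (B : Set _) = {s | edgeVector s ∈ b} :=
    (Set.toFinite {s : Finset (Sym2 V) | edgeVector s ∈ b}).exists_finset_coe
  have hmem : ∀ s ∈ B, edgeVector s ∈ b := fun s hs => by
    have : s ∈ (B : Set (Finset (Sym2 V))) := hs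
    rwa [hB] at this
  refine ⟨B, ?_, ?_, ?_⟩
  · intro s hs
    obtain ⟨t, ht, h⟩ := hb (hmem s hs)
    rwa [← edgeVector_injective h]
  · let f : B → b := fun s => ⟨edgeVector s.1, hmem s.1 s.2⟩
    have hf : Function.Injective f := fun s t h =>
      Subtype.ext (edgeVector_injective (congrArg Subtype.val h))
    exact hli.comp f hf
  · rw [hB, himg, hspan, cycleSpace]

theorem two_le_cyclomaticCharacteristic [Fintype V] : 2 ≤ cyclomaticCharacteristic G := by
  classical
  unfold cyclomaticCharacteristic
  split_ifs with h
  · exact le_rfl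
  · obtain ⟨B₀, hB₀⟩ := exists_isCycleBasis (G := G)
    refine le_csInf ⟨_, B₀, hB₀, rfl⟩ ?_
    rintro ℓ ⟨B, ⟨hcyc, -, hspan⟩, rfl⟩
    -- An empty basis would make the cycle space zero, although a cycle has a nonzero vector.
    obtain ⟨s, hs⟩ : B.Nonempty := by
      rw [Finset.nonempty_iff_ne_empty]
      rintro rfl
      apply h
      intro v c hc
      have hmem : edgeVector c.edges.toFinset ∈ cycleSpace G :=
        Submodule.subset_span ⟨_, ⟨v, c, hc, fun e => by rw [List.mem_toFinset]⟩, rfl⟩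
      rw [← hspan] at hmem
      simp only [Finset.coe_empty, Set.image_empty, Submodule.span_empty,
        Submodule.mem_bot] at hmem
      have hempty : c.edges.toFinset = ∅ := edgeVector_injective (by
        rw [hmem]
        funext e
        simp [edgeVector])
      have h3 := card_le_of_isCycleEdgeSet (G := G)
        ⟨v, c, hc, fun e => List.mem_toFinset (l := c.edges)⟩
      rw [hempty] at h3
      simp at h3
    have h3 := card_le_of_isCycleEdgeSet (hcyc s hs)
    have h4 : s.card ≤ B.sup Finset.card := Finset.le_sup (f := Finset.card) hs
    omega

end GraphLemmas

/-! ### The dynamics of one clock -/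

section ClockValues

variable {χ : IncrSystem}

theorem value_ext {x y : χ.Value} (h : x.1 = y.1) : x = y := Subtype.ext h

theorem φ_val_of_neg {x : χ.Value} (h : x.1 < 0) : (φ x).1 = x.1 + 1 := by
  unfold φ
  dsimp only
  rw [if_neg (by omega)]

theorem φ_val_of_nonneg {x : χ.Value} (h : 0 ≤ x.1) :
    (φ x).1 = if x.1 + 1 = χ.K then 0 else x.1 + 1 := by
  have h₂ := x.2.2
  unfold φ
  dsimp only
  rw [if_pos h]
  split_ifs with h₁
  · rw [h₁, Int.emod_self]
  · exact Int.emod_eq_of_lt (by omega) (by omega)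

theorem φ_nonneg {x : χ.Value} (h : 0 ≤ x.1) : 0 ≤ (φ x).1 := by
  rw [φ_val_of_nonneg h]
  split_ifs <;> omega

theorem resetValue_val : (resetValue χ).1 = -(χ.α : ℤ) := rfl

theorem resetValue_neg : (resetValue χ).1 < 0 := by
  have := χ.α_pos
  rw [resetValue_val]
  omega

theorem circDist_le_one_iff {x y : χ.Value} (hx : 0 ≤ x.1) (hy : 0 ≤ y.1) :
    circDist x y ≤ 1 ↔ x = y ∨ x = φ y ∨ φ x = y := by
  have hmod : ∀ a b : χ.Value, 0 ≤ a.1 → 0 ≤ b.1 →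
      (a.1 - b.1) % (χ.K : ℤ) = if b.1 ≤ a.1 then a.1 - b.1 else a.1 - b.1 + χ.K := by
    intro a b ha hb
    have ha₂ := a.2.2
    have hb₂ := b.2.2
    split_ifs with h
    · exact Int.emod_eq_of_lt (by omega) (by omega)
    · rw [← Int.add_emod_right]
      exact Int.emod_eq_of_lt (by omega) (by omega)
  have e : ∀ a b : χ.Value, a = b ↔ a.1 = b.1 := fun a b => Subtype.ext_iff
  have hx₂ := x.2.2
  have hy₂ := y.2.2
  rw [circDist, hmod x y hx hy, hmod y x hy hx, e, e, e, φ_val_of_nonneg hx, φ_val_of_nonneg hy,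
    min_le_iff]
  split_ifs <;> omega

end ClockValues

section ClockSteps

variable {V : Type*} {G : SimpleGraph V} {χ : IncrSystem}

/-- The effect of a step of the algorithm on one of the two clocks. -/
def ClockStep (G : SimpleGraph V) (r r' : V → χ.Value) : Prop :=
  ∀ p, r' p = r p ∨ (r' p = φ (r p) ∧ (NormalStep G r p ∨ ConvergenceStep G r p)) ∨
    (r' p = resetValue χ ∧ ResetInit G r p)

/-- The values at two vertices are ring values that differ by at most one increment. -/
def EdgeCorrect (r : V → χ.Value) (p q : V) : Prop :=
  0 ≤ (r p).1 ∧ 0 ≤ (r q).1 ∧ (r p = r q ∨ r p = φ (r q) ∨ φ (r p) = r q)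

theorem EdgeCorrect.symm {r : V → χ.Value} {p q : V} (h : EdgeCorrect r p q) :
    EdgeCorrect r q p := by
  obtain ⟨h₁, h₂, h₃⟩ := h
  refine ⟨h₂, h₁, ?_⟩
  rcases h₃ with h₃ | h₃ | h₃
  · exact Or.inl h₃.symm
  · exact Or.inr (Or.inr h₃.symm)
  · exact Or.inr (Or.inl h₃.symm)

theorem unisonPred_iff {r : V → χ.Value} :
    UnisonPred G r ↔ ∀ p q, G.Adj p q → EdgeCorrect r p q := by
  refine ⟨fun h p q hpq => ?_, fun h p q hpq => ?_⟩
  · have h₁ : 0 ≤ (r p).1 := (h p q hpq).1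
    have h₂ : 0 ≤ (r q).1 := (h q p hpq.symm).1
    exact ⟨h₁, h₂, (circDist_le_one_iff h₁ h₂).1 (h p q hpq).2⟩
  · obtain ⟨h₁, h₂, h₃⟩ := h p q hpq
    exact ⟨h₁, (circDist_le_one_iff h₁ h₂).2 h₃⟩

theorem NormalStep.edgeCorrect {r : V → χ.Value} {p q : V} (h : NormalStep G r p)
    (hpq : G.Adj p q) : EdgeCorrect r p q := by
  have h₁ : 0 ≤ (r p).1 := h.1
  rcases h.2 q hpq with h₂ | h₂
  · exact ⟨h₁, h₂ ▸ h₁, Or.inl h₂⟩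
  · exact ⟨h₁, h₂ ▸ φ_nonneg h₁, Or.inr (Or.inr h₂.symm)⟩

theorem LocallyCorrect.edgeCorrect {r : V → χ.Value} {p q : V} (h : LocallyCorrect G r p)
    (hpq : G.Adj p q) : EdgeCorrect r p q :=
  ⟨h.1, (h.2 q hpq).1, (h.2 q hpq).2⟩

theorem locallyCorrect_of_edgeCorrect {r : V → χ.Value} {p : V} (hp : 0 ≤ (r p).1)
    (h : ∀ q, G.Adj p q → EdgeCorrect r p q) : LocallyCorrect G r p :=
  ⟨hp, fun q hq => ⟨(h q hq).2.1, (h q hq).2.2⟩⟩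

/-- A vertex that neither resets nor leaves the negative values either keeps its value or makes
a normal step. -/
theorem ClockStep.stay_or_normal {r r' : V → χ.Value} (h : ClockStep G r r') {p : V}
    (hp : 0 ≤ (r p).1) (hp' : 0 ≤ (r' p).1) :
    r' p = r p ∨ (r' p = φ (r p) ∧ NormalStep G r p) := by
  rcases h p with h₁ | ⟨h₁, h₂ | h₂⟩ | ⟨h₁, h₂⟩
  · exact Or.inl h₁
  · exact Or.inr ⟨h₁, h₂⟩
  · have : (r p).1 < 0 := h₂.1
    omega
  · have := resetValue_neg (χ := χ)
    rw [h₁] at hp'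
    omega

theorem EdgeCorrect.step {r r' : V → χ.Value} (h : ClockStep G r r') {p q : V} (hpq : G.Adj p q)
    (hc : EdgeCorrect r p q) (hp' : 0 ≤ (r' p).1) (hq' : 0 ≤ (r' q).1) :
    EdgeCorrect r' p q := by
  refine ⟨hp', hq', ?_⟩
  rcases h.stay_or_normal hc.1 hp' with hp | ⟨hp, hnp⟩ <;>
    rcases h.stay_or_normal hc.2.1 hq' with hq | ⟨hq, hnq⟩
  · rw [hp, hq]
    exact hc.2.2
  · rw [hp, hq]
    rcases hnq.2 p hpq.symm with h₁ | h₁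
    · exact Or.inr (Or.inr (by rw [h₁]))
    · exact Or.inl h₁
  · rw [hp, hq]
    rcases hnp.2 q hpq with h₁ | h₁
    · exact Or.inr (Or.inl (by rw [h₁]))
    · exact Or.inl h₁.symm
  · rw [hp, hq]
    rcases hnp.2 q hpq with h₁ | h₁
    · exact Or.inl (by rw [h₁])
    · exact Or.inr (Or.inr (by rw [h₁]))

theorem UnisonPred.step {r r' : V → χ.Value} (h : ClockStep G r r') (hu : UnisonPred G r) :
    UnisonPred G r' := by
  rw [unisonPred_iff] at hu ⊢
  have key : ∀ p q, G.Adj p q → 0 ≤ (r' p).1 := by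
    intro p q hpq
    have hp := (hu p q hpq).1
    rcases h p with h₁ | ⟨h₁, h₂⟩ | ⟨h₁, h₂⟩
    · rwa [h₁]
    · rw [h₁]
      exact φ_nonneg hp
    · exact absurd (locallyCorrect_of_edgeCorrect hp (hu p)) h₂.1
  intro p q hpq
  exact (hu p q hpq).step h hpq (key p q hpq) (key q p hpq.symm)

/-- If no vertex can converge or reset, then the clock is in unison. -/
theorem unisonPred_of_disabled [Finite V] {r : V → χ.Value}
    (hconv : ∀ p, ¬ ConvergenceStep G r p) (hreset : ∀ p, ¬ ResetInit G r p) :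
    UnisonPred G r := by
  have hlc : ∀ p, 0 < (r p).1 → LocallyCorrect G r p := by
    intro p hp
    by_contra h
    exact hreset p ⟨h, fun h' : (r p).1 ≤ 0 => by omega⟩
  have hring : ∀ p, 0 ≤ (r p).1 := by
    by_contra! hneg
    obtain ⟨p₀, hp₀⟩ := hneg
    have : Nonempty V := ⟨p₀⟩
    -- At a negative minimum the convergence guard can fail only through a positive neighbor; but
    -- that neighbor is locally correct, which forces a ring value here.
    obtain ⟨p, hp⟩ := Finite.exists_min fun p => (r p).1
    have hpneg : (r p).1 < 0 := lt_of_le_of_lt (hp p₀) hp₀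
    refine hconv p ⟨hpneg, fun q hq => ⟨?_, hp q⟩⟩
    by_contra hqpos
    have hqpos' : 0 < (r q).1 := lt_of_not_ge hqpos
    have := ((hlc q hqpos').edgeCorrect hq.symm).2.1
    omega
  rw [unisonPred_iff]
  intro p q hpq
  rcases (hring p).lt_or_eq with hp | hp
  · exact (hlc p hp).edgeCorrect hpq
  · rcases (hring q).lt_or_eq with hq | hq
    · exact ((hlc q hq).edgeCorrect hpq.symm).symm
    · exact ⟨hring p, hring q, Or.inl (value_ext (hp.symm.trans hq))⟩

/-- An incorrect pair of neighbors with ring values is never created. -/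
theorem ClockStep.incorrect_backward {r r' : V → χ.Value} (h : ClockStep G r r') {p q : V}
    (hpq : G.Adj p q) (hp' : 0 ≤ (r' p).1) (hq' : 0 ≤ (r' q).1) (hc : ¬ EdgeCorrect r' p q) :
    0 ≤ (r p).1 ∧ 0 ≤ (r q).1 ∧ ¬ EdgeCorrect r p q := by
  have key : ∀ p q, G.Adj p q → 0 ≤ (r' p).1 → 0 ≤ (r' q).1 → ¬ EdgeCorrect r' p q →
      0 ≤ (r p).1 := by
    intro p q hpq hp' hq' hc
    by_contra hp
    push Not at hp
    apply hc
    rcases h p with h₁ | ⟨h₁, h₂ | h₂⟩ | ⟨h₁, h₂⟩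
    · rw [h₁] at hp'
      omega
    · have : 0 ≤ (r p).1 := h₂.1
      omega
    · have hp0 : (r' p).1 = 0 := by
        have := φ_val_of_neg hp
        rw [← h₁] at this
        omega
      obtain ⟨hq₁, hq₂⟩ : (r q).1 ≤ 0 ∧ (r p).1 ≤ (r q).1 := h₂.2 q hpq
      have hq0 : (r' q).1 = 0 := by
        rcases h q with h₃ | ⟨h₃, h₄ | h₄⟩ | ⟨h₃, h₄⟩
        · rw [h₃] at hq' ⊢
          omega
        · have := (h₄.edgeCorrect hpq.symm).2.1
          omega
        · have h₅ : (r q).1 < 0 := h₄.1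
          have := φ_val_of_neg h₅
          rw [← h₃] at this
          omega
        · exact absurd hq₁ h₄.2
      exact ⟨hp', hq', Or.inl (value_ext (hp0.trans hq0.symm))⟩
    · have := resetValue_neg (χ := χ)
      rw [h₁] at hp'
      omega
  have hp := key p q hpq hp' hq' hc
  have hq := key q p hpq.symm hq' hp' fun h => hc h.symm
  exact ⟨hp, hq, fun hcorr => hc (hcorr.step h hpq hp' hq')⟩

end ClockSteps

/-! ### Resets are finite in number -/

section Resets

variable {V : Type*} {G : SimpleGraph V} {χ : IncrSystem} {r : ℕ → V → χ.Value}

/-- The vertex `e.1` resets in the step from time `e.2` to time `e.2 + 1`. -/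
def IsReset (r : ℕ → V → χ.Value) (e : V × ℕ) : Prop :=
  0 < (r e.2 e.1).1 ∧ (r (e.2 + 1) e.1).1 < 0

/-- The reset `e` of a vertex causes the reset `e'` of a neighbor. -/
def Cause (G : SimpleGraph V) (r : ℕ → V → χ.Value) (e e' : V × ℕ) : Prop :=
  G.Adj e.1 e'.1 ∧ e.2 < e'.2 ∧ IsReset r e ∧ IsReset r e' ∧
    ∀ u, e.2 < u → u ≤ e'.2 → 0 < (r u e'.1).1 ∧ (r u e.1).1 < 0

theorem IsReset.spec (hr : ∀ t, ClockStep G (r t) (r (t + 1))) {e : V × ℕ} (h : IsReset r e) :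
    r (e.2 + 1) e.1 = resetValue χ ∧ ¬ LocallyCorrect G (r e.2) e.1 := by
  obtain ⟨h₁, h₂⟩ := h
  rcases hr e.2 e.1 with h₃ | ⟨h₃, -⟩ | ⟨h₃, h₄⟩
  · rw [h₃] at h₂
    omega
  · have := φ_nonneg h₁.le
    rw [← h₃] at this
    omega
  · exact ⟨h₃, h₄.1⟩

/-- As long as the neighbor `e'.1` is positive, the convergence guard of `e.1` fails, so `e.1` is
stuck at the reset value. -/
theorem Cause.val_eq (hr : ∀ t, ClockStep G (r t) (r (t + 1))) {e e' : V × ℕ}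
    (h : Cause G r e e') : ∀ u, e.2 < u → u ≤ e'.2 → (r u e.1).1 = -(χ.α : ℤ) := by
  obtain ⟨hadj, -, he, -, hval⟩ := h
  intro u hu
  induction u, hu using Nat.le_induction with
  | base =>
    intro _
    rw [(he.spec hr).1, resetValue_val]
  | succ u hu ih =>
    intro hu'
    have h₀ := hval u hu (by omega)
    refine Eq.trans ?_ (ih (by omega))
    rcases hr u e.1 with h₁ | ⟨h₁, h₂ | h₂⟩ | ⟨h₁, h₂⟩
    · rw [h₁]
    · have : 0 ≤ (r u e.1).1 := h₂.1
      omega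
    · have : (r u e'.1).1 ≤ 0 := (h₂.2 _ hadj).1
      omega
    · exact absurd h₀.2.le h₂.2

/-- If a vertex has a positive value and a neighbor has a negative one, this has been so since the
beginning or since the last reset of the neighbor. -/
theorem exists_reset_of_positive_of_negative (hr : ∀ t, ClockStep G (r t) (r (t + 1))) {p q : V}
    (hpq : G.Adj p q) (t : ℕ) (hp : 0 < (r t p).1) (hq : (r t q).1 < 0) :
    (∀ u ≤ t, 0 < (r u p).1 ∧ (r u q).1 < 0) ∨
      ∃ s < t, IsReset r (q, s) ∧ ∀ u, s < u → u ≤ t → 0 < (r u p).1 ∧ (r u q).1 < 0 := by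
  induction t with
  | zero =>
    left
    intro u hu
    obtain rfl : u = 0 := by omega
    exact ⟨hp, hq⟩
  | succ t ih =>
    by_cases hq₀ : 0 < (r t q).1
    · right
      refine ⟨t, by omega, ⟨hq₀, hq⟩, fun u hu hu' => ?_⟩
      obtain rfl : u = t + 1 := by omega
      exact ⟨hp, hq⟩
    have hq₁ : (r t q).1 < 0 := by
      rcases hr t q with h₁ | ⟨h₁, -⟩ | ⟨-, h₂⟩
      · rwa [h₁] at hq
      · by_contra h
        have := φ_nonneg (x := r t q) (by omega)
        rw [← h₁] at this
        omega
      · exact absurd (not_lt.1 hq₀) h₂.2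
    have hp₁ : 0 < (r t p).1 := by
      rcases hr t p with h₁ | ⟨h₁, h₂ | h₂⟩ | ⟨h₁, -⟩
      · rwa [h₁] at hp
      · have := (h₂.edgeCorrect hpq).2.1
        omega
      · have h₃ : (r t p).1 < 0 := h₂.1
        have := φ_val_of_neg h₃
        rw [← h₁] at this
        omega
      · have := resetValue_neg (χ := χ)
        rw [h₁] at hp
        omega
    rcases ih hp₁ hq₁ with h | ⟨s, hs, hs₁, hs₂⟩
    · left
      intro u hu
      rcases hu.lt_or_eq with hu | rfl
      · exact h u (by omega)
      · exact ⟨hp, hq⟩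
    · right
      refine ⟨s, by omega, hs₁, fun u hu hu' => ?_⟩
      rcases hu'.lt_or_eq with hu' | rfl
      · exact hs₂ u hu (by omega)
      · exact ⟨hp, hq⟩

/-- Iterates `ClockStep.incorrect_backward` down to time `0`. An incorrect edge inside the ring is
inherited from the start, so its endpoints have never been reset. -/
theorem ring_incorrect_backward (hr : ∀ t, ClockStep G (r t) (r (t + 1))) {p q : V}
    (hpq : G.Adj p q) (t : ℕ) (hp : 0 ≤ (r t p).1) (hq : 0 ≤ (r t q).1)
    (hc : ¬ EdgeCorrect (r t) p q) : ∀ u ≤ t, 0 ≤ (r u p).1 := by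
  induction t with
  | zero =>
    intro u hu
    obtain rfl : u = 0 := by omega
    exact hp
  | succ t ih =>
    obtain ⟨h₁, h₂, h₃⟩ := (hr t).incorrect_backward hpq hp hq hc
    intro u hu
    rcases hu.lt_or_eq with hu | rfl
    · exact ih h₁ h₂ h₃ u (by omega)
    · exact hp

/-- Every reset has a cause or is the first reset of its vertex. -/
theorem IsReset.exists_cause (hr : ∀ t, ClockStep G (r t) (r (t + 1))) {e : V × ℕ}
    (he : IsReset r e) :
    (∃ e', Cause G r e' e) ∨ ∀ u < e.2, ¬ IsReset r (e.1, u) := by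
  have hnc := (he.spec hr).2
  have hex : ∃ q, G.Adj e.1 q ∧ ¬ EdgeCorrect (r e.2) e.1 q := by
    by_contra! h
    exact hnc (locallyCorrect_of_edgeCorrect he.1.le h)
  obtain ⟨q, hpq, hc⟩ := hex
  -- An incorrect edge has either a negative far end, whose last reset is the cause unless the
  -- situation is initial, or two ring values, which rules out earlier resets.
  rcases lt_or_ge (r e.2 q).1 0 with hq | hq
  · rcases exists_reset_of_positive_of_negative hr hpq e.2 he.1 hq with h | ⟨s, hs, hs₁, hs₂⟩
    · right
      intro u hu hreset
      have h₁ := (h (u + 1) hu).1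
      have h₂ : (r (u + 1) e.1).1 < 0 := hreset.2
      omega
    · exact Or.inl ⟨(q, s), hpq.symm, hs, hs₁, he, hs₂⟩
  · right
    intro u hu hreset
    have h₁ := ring_incorrect_backward hr hpq e.2 he.1.le hq hc (u + 1) hu
    have h₂ : (r (u + 1) e.1).1 < 0 := hreset.2
    omega

/-- `f 0, …, f n` is a chain of resets, each of which causes the next one, that starts with
the first reset of some vertex. -/
def IsResetChain (G : SimpleGraph V) (r : ℕ → V → χ.Value) (f : ℕ → V × ℕ) (n : ℕ) : Prop :=
  (IsReset r (f 0) ∧ ∀ u < (f 0).2, ¬ IsReset r ((f 0).1, u)) ∧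
    ∀ k < n, Cause G r (f k) (f (k + 1))

/-- Some chain of resets of length `n` ends with `e`. -/
def ResetDepth (G : SimpleGraph V) (r : ℕ → V → χ.Value) (n : ℕ) (e : V × ℕ) : Prop :=
  ∃ f, IsResetChain G r f n ∧ f n = e

theorem ResetDepth.succ {n : ℕ} {e e' : V × ℕ} (h : ResetDepth G r n e) (hc : Cause G r e e') :
    ResetDepth G r (n + 1) e' := by
  obtain ⟨f, ⟨h₀, hf⟩, rfl⟩ := h
  refine ⟨fun k => if k ≤ n then f k else e', ⟨by simpa using h₀, fun k hk => ?_⟩, by simp⟩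
  rcases Nat.lt_or_ge k n with hk' | hk'
  · have h₁ : k ≤ n := hk'.le
    have h₂ : k + 1 ≤ n := hk'
    simpa only [h₁, h₂, if_true] using hf k hk'
  · obtain rfl : k = n := by omega
    simpa using hc

theorem IsReset.exists_depth (hr : ∀ t, ClockStep G (r t) (r (t + 1))) {e : V × ℕ}
    (he : IsReset r e) : ∃ n, ResetDepth G r n e := by
  obtain ⟨p, t⟩ := e
  induction t using Nat.strong_induction_on generalizing p with
  | _ t ih =>
    rcases he.exists_cause hr with ⟨⟨q, s⟩, hc⟩ | h
    · obtain ⟨n, hn⟩ := ih s hc.2.1 q hc.2.2.1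
      exact ⟨n + 1, hn.succ hc⟩
    · exact ⟨0, fun _ => (p, t), ⟨⟨he, h⟩, fun k hk => absurd hk (Nat.not_lt_zero k)⟩, rfl⟩

/-- A vertex of a chain of resets climbs by at most one with each further member of the chain. -/
theorem IsResetChain.val_le (hr : ∀ t, ClockStep G (r t) (r (t + 1))) {f : ℕ → V × ℕ} {n : ℕ}
    (hf : IsResetChain G r f n) (d : ℕ) (hd : d ≤ χ.α) :
    ∀ i, i + d + 1 ≤ n → ∀ u, (f i).2 < u → u ≤ (f (i + d + 1)).2 →
      (r u (f i).1).1 ≤ -(χ.α : ℤ) + d := by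
  induction d with
  | zero =>
    intro i hi u hu hu'
    have := (hf.2 i (by omega)).val_eq hr u hu hu'
    omega
  | succ d ih =>
    intro i hi u hu
    have hc := hf.2 i (by omega)
    induction u, hu using Nat.le_induction with
    | base =>
      intro _
      have := hc.val_eq hr _ (Nat.lt_succ_self _) hc.2.1
      omega
    | succ u hu ihu =>
      intro hu'
      rcases Nat.lt_or_ge (f (i + 1)).2 (u + 1) with hlt | hge
      · have h₀ := ihu (by omega)
        rcases Nat.lt_or_ge (f (i + 1)).2 u with hlt' | hge'
        · have hnext := ih (by omega) (i + 1) (by omega) u hlt' (by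
            rw [show i + 1 + d + 1 = i + (d + 1) + 1 by omega]
            omega)
          rcases hr u (f i).1 with h₁ | ⟨h₁, h₂ | h₂⟩ | ⟨h₁, h₂⟩
          · rwa [h₁]
          · have := (h₂.edgeCorrect hc.1).2.1
            omega
          · have h₃ := (h₂.2 _ hc.1).2
            rw [h₁, φ_val_of_neg h₂.1]
            push_cast
            omega
          · rw [h₁, resetValue_val]
            omega
        -- At the very time of reset `f (i + 1)`, vertex `f i` is still at `-α`, so one step brings
        -- it to at most `-α + 1`.
        · have hα := χ.α_pos
          have h₃ := hc.val_eq hr u hu (by omega)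
          rcases hr u (f i).1 with h₁ | ⟨h₁, -⟩ | ⟨h₁, -⟩
          · rw [h₁]
            omega
          · rw [h₁, φ_val_of_neg (by omega)]
            push_cast
            omega
          · rw [h₁, resetValue_val]
            omega
      · have := hc.val_eq hr (u + 1) (by omega) hge
        omega

theorem IsResetChain.time_lt {f : ℕ → V × ℕ} {n : ℕ} (hf : IsResetChain G r f n) {i j : ℕ}
    (hij : i < j) (hj : j ≤ n) : (f i).2 < (f j).2 := by
  induction j, hij using Nat.le_induction with
  | base => exact (hf.2 i (by omega)).2.1
  | succ j hij ih => exact (ih (by omega)).trans (hf.2 j (by omega)).2.1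

theorem IsResetChain.isReset {f : ℕ → V × ℕ} {n : ℕ} (hf : IsResetChain G r f n) {i : ℕ}
    (hi : i ≤ n) : IsReset r (f i) := by
  rcases Nat.eq_zero_or_pos i with rfl | hpos
  · exact hf.1.1
  · have := (hf.2 (i - 1) (by omega)).2.2.2.1
    rwa [Nat.sub_add_cancel hpos] at this

/-- A shortest chain of resets has fewer links than the graph has vertices. -/
theorem ResetDepth.lt_card [Fintype V] (hα : greatestHole G ≤ χ.α)
    (hr : ∀ t, ClockStep G (r t) (r (t + 1))) {n : ℕ} {e : V × ℕ} (h : ResetDepth G r n e)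
    (hmin : ∀ m, ResetDepth G r m e → n ≤ m) : n < Fintype.card V := by
  obtain ⟨f, hf, rfl⟩ := h
  have hprefix : ∀ i ≤ n, ResetDepth G r i (f i) := fun i hi =>
    ⟨f, ⟨hf.1, fun k hk => hf.2 k (by omega)⟩, rfl⟩
  -- Any other chain ending at `f i` can be continued by the remaining links of `f`.
  have hextend : ∀ d i m, i + d = n → ResetDepth G r m (f i) → ResetDepth G r (m + d) (f n) := by
    intro d
    induction d with
    | zero =>
      rintro i m rfl hm
      exact hm
    | succ d ih =>
      intro i m hi hm
      have := ih (i + 1) (m + 1) (by omega) (hm.succ (hf.2 i (by omega)))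
      rwa [show m + 1 + d = m + (d + 1) by omega] at this
  refine length_lt_card_of_no_short_return χ.α_pos hα (fun k => (f k).1) n
    (fun k hk => (hf.2 k hk).1) ?_ ?_
  -- Within `α + 1` links the earlier vertex is still at most `0`, whereas a vertex resets from a
  -- positive value.
  · intro i j hij hj hja heq
    have h₁ := hf.val_le hr (j - i - 1) (by omega) i (by omega) (f j).2 (hf.time_lt hij hj)
      (by rw [show i + (j - i - 1) + 1 = j by omega])
    have h₂ : 0 < (r (f j).2 (f j).1).1 := (hf.isReset hj).1
    have heq' : (f i).1 = (f j).1 := heq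
    rw [heq'] at h₁
    omega
  · intro i j hij hj hja hadj
    have hlt := hf.time_lt (show i < j by omega) hj
    have hneg : ∀ u, (f i).2 < u → u ≤ (f j).2 → (r u (f i).1).1 < 0 := by
      intro u hu hu'
      have := hf.val_le hr (j - i - 1) (by omega) i (by omega) u hu
        (by rwa [show i + (j - i - 1) + 1 = j by omega])
      omega
    have hi := hf.isReset (show i ≤ n by omega)
    -- Within `α` links `f i` is still negative, so its latest reset before `f j` is `f i` itself.
    -- By adjacency it causes `f j` directly, a shortcut that contradicts minimality.
    have hcause : Cause G r (f i) (f j) := by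
      rcases exists_reset_of_positive_of_negative hr (show G.Adj (f j).1 (f i).1 from hadj.symm)
        (f j).2 (hf.isReset hj).1 (hneg _ hlt le_rfl) with h | ⟨s, hs, hs₁, hs₂⟩
      · have h₁ := (h (f i).2 hlt.le).2
        have h₂ := hi.1
        omega
      · obtain rfl : s = (f i).2 := by
          rcases lt_trichotomy s (f i).2 with h | h | h
          · have h₁ := (hs₂ _ h hlt.le).2
            have h₂ := hi.1
            omega
          · exact h
          · have h₁ := hneg s h hs.le
            have h₂ : 0 < (r s (f i).1).1 := hs₁.1
            omega
        exact ⟨hadj, hlt, hi, hf.isReset hj, hs₂⟩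
    have := hmin _ (hextend (n - j) j (i + 1) (by omega) ((hprefix i (by omega)).succ hcause))
    omega

/-- Depth `0` contains only first resets, one per vertex. A reset causes at most one reset per
neighbor, because the neighbor must stay positive in between; so finiteness passes to the next
depth. -/
theorem finite_setOf_resetDepth [Finite V] (n : ℕ) : {e | ResetDepth G r n e}.Finite := by
  induction n with
  | zero =>
    refine Set.Finite.of_finite_image (f := Prod.fst) (Set.toFinite _) ?_
    rintro ⟨p, t⟩ ⟨f, hf, hfe⟩ ⟨p', t'⟩ ⟨f', hf', hfe'⟩ (rfl : p = p')
    have h₁ := hf.1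
    have h₂ := hf'.1
    rw [hfe] at h₁
    rw [hfe'] at h₂
    rcases lt_trichotomy t t' with h | rfl | h
    · exact absurd h₁.1 (h₂.2 t h)
    · rfl
    · exact absurd h₂.1 (h₁.2 t' h)
  | succ n ih =>
    have hfin : ∀ e : V × ℕ, {e' | Cause G r e e'}.Finite := by
      intro e
      refine Set.Finite.of_finite_image (f := Prod.fst) (Set.toFinite _) ?_
      have key : ∀ p t t', Cause G r e (p, t) → Cause G r e (p, t') → ¬ t < t' := by
        intro p t t' h h' hlt
        have h₁ := (h'.2.2.2.2 (t + 1) (Nat.lt_succ_of_lt h.2.1) hlt).1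
        have h₂ : (r (t + 1) p).1 < 0 := h.2.2.2.1.2
        have h₃ : 0 < (r (t + 1) p).1 := h₁
        omega
      rintro ⟨p, t⟩ h ⟨p', t'⟩ h' (rfl : p = p')
      have h₁ := key p t t' h h'
      have h₂ := key p t' t h' h
      exact Prod.ext rfl (show t = t' by omega)
    refine (ih.biUnion fun e _ => hfin e).subset ?_
    rintro e ⟨f, hf, rfl⟩
    rw [Set.mem_iUnion₂]
    exact ⟨f n, ⟨f, ⟨hf.1, fun k hk => hf.2 k (by omega)⟩, rfl⟩, hf.2 n (by omega)⟩

theorem eventually_no_reset [Fintype V] (hα : greatestHole G ≤ χ.α)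
    (hr : ∀ t, ClockStep G (r t) (r (t + 1))) : ∃ N, ∀ t ≥ N, ∀ p, ¬ IsReset r (p, t) := by
  classical
  have hfin : {e | IsReset r e}.Finite := by
    refine ((Set.finite_lt_nat (Fintype.card V)).biUnion
      fun n _ => finite_setOf_resetDepth (G := G) (r := r) n).subset ?_
    intro e he
    have hex := IsReset.exists_depth hr he
    rw [Set.mem_iUnion₂]
    exact ⟨Nat.find hex, (Nat.find_spec hex).lt_card hα hr fun m => Nat.find_min' hex,
      Nat.find_spec hex⟩
  obtain ⟨N, hN⟩ := (hfin.image Prod.snd).bddAbove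
  refine ⟨N + 1, fun t ht p h => ?_⟩
  have := hN ⟨(p, t), h, rfl⟩
  simp only at this
  omega

/-- Eventually no vertex resets, and no vertex has a negative value that changes. -/
theorem eventually_no_reset_no_convergence [Fintype V] (hα : greatestHole G ≤ χ.α)
    (hr : ∀ t, ClockStep G (r t) (r (t + 1))) :
    ∃ N, ∀ t ≥ N, ∀ p, (0 ≤ (r t p).1 → 0 ≤ (r (t + 1) p).1) ∧
      ((r t p).1 < 0 → r (t + 1) p = r t p) := by
  obtain ⟨N, hN⟩ := eventually_no_reset hα hr
  have hmono : ∀ t ≥ N, ∀ p, (0 ≤ (r t p).1 → 0 ≤ (r (t + 1) p).1) ∧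
      ((r t p).1 < 0 → r (t + 1) p = r t p ∨ (r (t + 1) p).1 = (r t p).1 + 1) := by
    intro t ht p
    refine ⟨fun hp => ?_, fun hp => ?_⟩
    · rcases hr t p with h₁ | ⟨h₁, -⟩ | ⟨h₁, h₂⟩
      · rwa [h₁]
      · rw [h₁]
        exact φ_nonneg hp
      · refine absurd ⟨lt_of_not_ge h₂.2, ?_⟩ (hN t ht p)
        change (r (t + 1) p).1 < 0
        rw [h₁]
        exact resetValue_neg
    · rcases hr t p with h₁ | ⟨h₁, -⟩ | ⟨h₁, h₂⟩
      · exact Or.inl h₁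
      · right
        rw [h₁, φ_val_of_neg hp]
      · exact absurd hp.le h₂.2
  have hp : ∀ p, ∃ M ≥ N, ∀ t ≥ M, (r t p).1 < 0 → r (t + 1) p = r t p := by
    intro p
    -- The potential `(-r).toNat` never increases after `N`, and an increment of a negative value
    -- lowers it. From a time `M` where it is minimal, no such increment occurs.
    have hex : ∃ k : ℕ, ∃ t ≥ N, (-(r t p).1).toNat = k := ⟨_, N, le_rfl, rfl⟩
    classical
    obtain ⟨M, hM, hk⟩ := Nat.find_spec hex
    have hmin : ∀ t ≥ N, (-(r M p).1).toNat ≤ (-(r t p).1).toNat := fun t ht => by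
      rw [hk]
      exact Nat.find_min' hex ⟨t, ht, rfl⟩
    have hle : ∀ t ≥ M, (-(r t p).1).toNat ≤ (-(r M p).1).toNat := by
      intro t ht
      induction t, ht using Nat.le_induction with
      | base => exact le_rfl
      | succ t ht ih =>
        have h₁ := hmono t (by omega) p
        rcases lt_or_ge (r t p).1 0 with h₂ | h₂
        · rcases h₁.2 h₂ with h₃ | h₃
          · rwa [h₃]
          · omega
        · have := h₁.1 h₂
          omega
    refine ⟨M, hM, fun t ht hneg => ?_⟩
    rcases (hmono t (by omega) p).2 hneg with h | h
    · exact h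
    · have := hmin (t + 1) (by omega)
      have := hle t ht
      omega
  choose M hM hM' using hp
  obtain ⟨B, hB⟩ := (Set.finite_range M).bddAbove
  refine ⟨max N B, fun t ht p => ⟨(hmono t (by omega) p).1, hM' p t ?_⟩⟩
  have := hB ⟨p, rfl⟩
  omega

end Resets

/-! ### The two-layer clock -/

section TwoLayers

variable {V : Type*} {G : SimpleGraph V} {χ₁ χ₂ : IncrSystem} {A : Type*} {ρ : ℕ}
  {app : Application G χ₁ χ₂ A}

theorem normalAction_r₁ (γ : Config V χ₁ χ₂ A) (p : V) :
    (normalAction ρ app γ p).r₁ = φ (γ p).r₁ := by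
  unfold normalAction slaveStep
  dsimp only
  split_ifs <;> rfl

theorem normalAction_r₂ (γ : Config V χ₁ χ₂ A) (p : V) :
    (normalAction ρ app γ p).r₂ = (γ p).r₂ ∨
      ((normalAction ρ app γ p).r₂ = φ (γ p).r₂ ∧ NormalStep G (fun q => (γ q).r₂) p) := by
  unfold normalAction slaveStep
  dsimp only
  split_ifs with h₁ h₂ h₃
  · exact Or.inr ⟨rfl, h₂.1⟩
  · exact Or.inl rfl
  · exact Or.inl rfl
  · exact Or.inl rfl

theorem Step.clockStep₁ {γ γ' : Config V χ₁ χ₂ A} (h : Step ρ app γ γ') :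
    ClockStep G (fun p => (γ p).r₁) (fun p => (γ' p).r₁) := by
  obtain ⟨σ, -, hsome, hnone⟩ := h
  intro p
  dsimp only
  rcases hσ : σ p with _ | a
  · exact Or.inl (by rw [hnone p hσ])
  · obtain ⟨hg, he⟩ := hsome p a hσ
    rw [he]
    cases a with
    | NA => exact Or.inr (Or.inl ⟨normalAction_r₁ γ p, Or.inl hg.1⟩)
    | CA₁ => exact Or.inr (Or.inl ⟨rfl, Or.inr hg⟩)
    | CA₂ => exact Or.inl rfl
    | RA₁ => exact Or.inr (Or.inr ⟨rfl, hg⟩)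
    | RA₂ => exact Or.inl rfl

/-- `NA` increments the slave clock only after testing `NormalStep` on it, so this layer has the
same abstract dynamics as the master. -/
theorem Step.clockStep₂ {γ γ' : Config V χ₁ χ₂ A} (h : Step ρ app γ γ') :
    ClockStep G (fun p => (γ p).r₂) (fun p => (γ' p).r₂) := by
  obtain ⟨σ, -, hsome, hnone⟩ := h
  intro p
  dsimp only
  rcases hσ : σ p with _ | a
  · exact Or.inl (by rw [hnone p hσ])
  · obtain ⟨hg, he⟩ := hsome p a hσ
    rw [he]
    cases a with
    | NA =>
      rcases normalAction_r₂ (ρ := ρ) (app := app) γ p with h | ⟨h, h'⟩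
      · exact Or.inl h
      · exact Or.inr (Or.inl ⟨h, Or.inl h'⟩)
    | CA₁ => exact Or.inl rfl
    | CA₂ => exact Or.inr (Or.inl ⟨rfl, Or.inr hg⟩)
    | RA₁ => exact Or.inl rfl
    | RA₂ => exact Or.inr (Or.inr ⟨rfl, hg⟩)

theorem closed_WU : Closed (Step ρ app) (WU G) := by
  intro e h₀ i
  induction i with
  | zero => exact fun _ => h₀
  | succ i ih =>
    intro hi
    have hlt : (i : ℕ∞) < e.last := lt_of_lt_of_le (by exact_mod_cast Nat.lt_succ_self i) hi
    have hs := e.step i hlt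
    have hw := ih hlt.le
    exact ⟨UnisonPred.step hs.clockStep₁ hw.1, UnisonPred.step hs.clockStep₂ hw.2⟩

theorem exists_step_of_guard {γ : Config V χ₁ χ₂ A} {p : V} {a : Action} (h : Guard G γ p a) :
    ∃ γ', Step ρ app γ γ' := by
  classical
  refine ⟨fun q => if q = p then exec ρ app γ p a else γ q,
    fun q => if q = p then some a else none, ⟨p, a, if_pos rfl⟩, ?_, ?_⟩
  · intro q b hq
    dsimp only at hq ⊢
    split_ifs at hq ⊢ with hqp
    obtain rfl : a = b := Option.some.inj hq
    subst hqp
    exact ⟨h, rfl⟩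
  · intro q hq
    dsimp only at hq ⊢
    split_ifs at hq ⊢
    rfl

theorem WU_of_terminal [Finite V] {γ : Config V χ₁ χ₂ A} (h : ∀ γ', ¬ Step ρ app γ γ') :
    WU G γ := by
  have hg : ∀ p a, ¬ Guard G γ p a := fun p a hpa =>
    (exists_step_of_guard hpa).elim fun γ' hγ' => h γ' hγ'
  exact ⟨unisonPred_of_disabled (fun p => hg p .CA₁) (fun p => hg p .RA₁),
    unisonPred_of_disabled (fun p => hg p .CA₂) (fun p => hg p .RA₂)⟩

/-- Process `p` may have executed action `NA` in the step from time `t` to time `t + 1`. -/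
def IsNormalMove (G : SimpleGraph V) (s : ℕ → Config V χ₁ χ₂ A) (p : V) (t : ℕ) : Prop :=
  Guard G (s t) p .NA ∧ (s (t + 1) p).r₁ = φ (s t p).r₁

/-- A step in which no clock makes a converging or resetting move consists of normal moves. -/
theorem Step.normalMoves {s : ℕ → Config V χ₁ χ₂ A} {t : ℕ} (h : Step ρ app (s t) (s (t + 1)))
    (h₁ : ∀ p, (0 ≤ (s t p).r₁.1 → 0 ≤ (s (t + 1) p).r₁.1) ∧
      ((s t p).r₁.1 < 0 → (s (t + 1) p).r₁ = (s t p).r₁))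
    (h₂ : ∀ p, (0 ≤ (s t p).r₂.1 → 0 ≤ (s (t + 1) p).r₂.1) ∧
      ((s t p).r₂.1 < 0 → (s (t + 1) p).r₂ = (s t p).r₂)) :
    (∃ p, IsNormalMove G s p t) ∧
      ∀ p, IsNormalMove G s p t ∨ (s (t + 1) p).r₁ = (s t p).r₁ := by
  obtain ⟨σ, ⟨p₀, a₀, h₀⟩, hsome, hnone⟩ := h
  have hconv : ∀ {χ : IncrSystem} {x : χ.Value}, x.1 < 0 → φ x ≠ x := by
    intro χ x hx heq
    have := φ_val_of_neg hx
    rw [heq] at this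
    omega
  -- A convergence action would change a negative value, and a reset would turn a ring value
  -- negative; the hypotheses exclude both.
  have key : ∀ p a, σ p = some a → IsNormalMove G s p t := by
    intro p a hσ
    obtain ⟨hg, he⟩ := hsome p a hσ
    cases a with
    | NA => exact ⟨hg, by rw [he]; exact normalAction_r₁ _ _⟩
    | CA₁ =>
      have := (h₁ p).2 hg.1
      rw [he] at this
      exact absurd this (hconv hg.1)
    | CA₂ =>
      have := (h₂ p).2 hg.1
      rw [he] at this
      exact absurd this (hconv hg.1)
    | RA₁ =>
      have := (h₁ p).1 (lt_of_not_ge hg.2).le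
      rw [he] at this
      exact absurd resetValue_neg this.not_gt
    | RA₂ =>
      have := (h₂ p).1 (lt_of_not_ge hg.2).le
      rw [he] at this
      exact absurd resetValue_neg this.not_gt
  refine ⟨⟨p₀, key p₀ a₀ h₀⟩, fun p => ?_⟩
  rcases hσ : σ p with _ | a
  · exact Or.inr (by rw [hnone p hσ])
  · exact Or.inl (key p a hσ)

/-- For `K ≥ 3` the values `x`, `φ x`, `φ (φ x)` are distinct, so the first two conditions force `y
= φ x`, which the third excludes. With `K = 2` this would fail, as then `φ (φ (φ x)) = φ x`. -/
theorem not_three_normalSteps {χ : IncrSystem} (hK : 3 ≤ χ.K) {x y : χ.Value} (hx : 0 ≤ x.1)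
    (h₀ : x = y ∨ y = φ x) (h₁ : φ x = y ∨ y = φ (φ x))
    (h₂ : φ (φ x) = y ∨ y = φ (φ (φ x))) : False := by
  have e : ∀ a b : χ.Value, a = b ↔ a.1 = b.1 := fun a b => Subtype.ext_iff
  have hx₁ := φ_nonneg hx
  have hx₂ := φ_nonneg hx₁
  have e₁ := φ_val_of_nonneg hx
  have e₂ := φ_val_of_nonneg hx₁
  have e₃ := φ_val_of_nonneg hx₂
  rw [e, e] at h₀ h₁ h₂
  split_ifs at e₁ e₂ e₃ <;> omega

/-- If all moves are normal moves, then a process that moves infinitely often has neighbors that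
move infinitely often. -/
theorem infinitely_often_of_adj {s : ℕ → Config V χ₁ χ₂ A} {N : ℕ} (hK : 3 ≤ χ₁.K)
    (hs : ∀ t ≥ N, ∀ p, IsNormalMove G s p t ∨ (s (t + 1) p).r₁ = (s t p).r₁) {p q : V}
    (hpq : G.Adj p q) (hp : ∀ M, ∃ t ≥ M, IsNormalMove G s p t) :
    ∀ M, ∃ t ≥ M, IsNormalMove G s q t := by
  classical
  intro M
  by_contra! hq
  have hconst : ∀ t ≥ max M N, (s t q).r₁ = (s (max M N) q).r₁ := by
    intro t ht
    induction t, ht using Nat.le_induction with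
    | base => rfl
    | succ t ht ih =>
      rcases hs t (by omega) q with h | h
      · exact absurd h (hq t (by omega))
      · rw [h, ih]
  -- The first move of `p` from `T` on finds the value of time `T` unchanged, since only moves
  -- change it. Three consecutive moves thus face the same constant neighbor value.
  have hnext : ∀ T ≥ N, ∃ t ≥ T, IsNormalMove G s p t ∧ (s t p).r₁ = (s T p).r₁ := by
    intro T hT
    obtain ⟨hle, hmove⟩ := Nat.find_spec (hp T)
    have hstay : ∀ t ≥ T, t ≤ Nat.find (hp T) → (s t p).r₁ = (s T p).r₁ := by
      intro t ht
      induction t, ht using Nat.le_induction with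
      | base => exact fun _ => rfl
      | succ t ht ih =>
        intro hlt
        rcases hs t (by omega) p with h | h
        · exact absurd ⟨ht, h⟩ (Nat.find_min (hp T) hlt)
        · rw [h, ih (by omega)]
    exact ⟨_, hle, hmove, hstay _ hle le_rfl⟩
  obtain ⟨t₀, ht₀, hm₀, -⟩ := hnext (max M N) (by omega)
  obtain ⟨t₁, ht₁, hm₁, he₁⟩ := hnext (t₀ + 1) (by omega)
  obtain ⟨t₂, ht₂, hm₂, he₂⟩ := hnext (t₁ + 1) (by omega)
  rw [hm₀.2] at he₁
  rw [hm₁.2, he₁] at he₂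
  have h₀ := hm₀.1.1.2 q hpq
  have h₁ := hm₁.1.1.2 q hpq
  have h₂ := hm₂.1.1.2 q hpq
  dsimp only at h₀ h₁ h₂
  rw [hconst _ (by omega)] at h₀ h₁ h₂
  rw [he₁] at h₁
  rw [he₂] at h₂
  exact not_three_normalSteps hK hm₀.1.1.1 h₀ h₁ h₂

theorem exists_WU_of_infinite [Fintype V] (hG : G.Connected) (hK : 3 ≤ χ₁.K)
    (hα₁ : greatestHole G ≤ χ₁.α) (hα₂ : greatestHole G ≤ χ₂.α) {s : ℕ → Config V χ₁ χ₂ A}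
    (hs : ∀ t, Step ρ app (s t) (s (t + 1))) : ∃ t, WU G (s t) := by
  obtain ⟨N₁, hN₁⟩ := eventually_no_reset_no_convergence (G := G)
    (r := fun t p => (s t p).r₁) hα₁ fun t => (hs t).clockStep₁
  obtain ⟨N₂, hN₂⟩ := eventually_no_reset_no_convergence (G := G)
    (r := fun t p => (s t p).r₂) hα₂ fun t => (hs t).clockStep₂
  have hmoves : ∀ t ≥ max N₁ N₂, _ := fun t ht =>
    (hs t).normalMoves (hN₁ t (by omega)) (hN₂ t (by omega))
  -- Every late step contains a normal move, and there are finitely many processes.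
  obtain ⟨p₀, hp₀⟩ : ∃ p, ∀ M, ∃ t ≥ M, IsNormalMove G s p t := by
    by_contra! h
    choose M hM using h
    obtain ⟨B, hB⟩ := (Set.finite_range M).bddAbove
    obtain ⟨p, hp⟩ := (hmoves (max (max N₁ N₂) B) (by omega)).1
    exact hM p _ (le_trans (hB ⟨p, rfl⟩) (by omega)) hp
  have hall : ∀ p, ∀ M, ∃ t ≥ M, IsNormalMove G s p t := by
    intro p
    obtain ⟨w⟩ := hG.preconnected p₀ p
    induction w with
    | nil => exact hp₀
    | cons hadj _ ih => exact ih (infinitely_often_of_adj hK (fun t ht => (hmoves t ht).2) hadj hp₀)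
  -- A single `NA` move of `p` suffices: its guard gives correctness of the incident edges on both
  -- clocks, and afterwards ring values remain ring values.
  have hcorrect : ∀ p, ∃ T, ∀ t ≥ T, ∀ q, G.Adj p q →
      EdgeCorrect (fun v => (s t v).r₁) p q ∧ EdgeCorrect (fun v => (s t v).r₂) p q := by
    intro p
    obtain ⟨T, hT, hm⟩ := hall p (max N₁ N₂)
    refine ⟨T, fun t ht q hpq => ?_⟩
    induction t, ht using Nat.le_induction with
    | base => exact ⟨hm.1.1.edgeCorrect hpq, hm.1.2.edgeCorrect hpq⟩
    | succ t ht ih =>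
      have h₁ := hN₁ t (by omega)
      have h₂ := hN₂ t (by omega)
      exact ⟨ih.1.step (hs t).clockStep₁ hpq ((h₁ p).1 ih.1.1) ((h₁ q).1 ih.1.2.1),
        ih.2.step (hs t).clockStep₂ hpq ((h₂ p).1 ih.2.1) ((h₂ q).1 ih.2.2.1)⟩
  choose T hT using hcorrect
  obtain ⟨B, hB⟩ := (Set.finite_range T).bddAbove
  exact ⟨B, unisonPred_iff.2 fun p q hpq => (hT p B (hB ⟨p, rfl⟩) q hpq).1,
    unisonPred_iff.2 fun p q hpq => (hT p B (hB ⟨p, rfl⟩) q hpq).2⟩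

end TwoLayers

end LayerClock

theorem mainTheorem3 {V : Type*} [Fintype V] (G : SimpleGraph V) (hG : G.Connected)
    (hV : 2 ≤ Fintype.card V) (ρ : ℕ) (hρ : 0 < ρ)
    (χ₁ χ₂ : LayerClock.IncrSystem)
    (hα₁ : LayerClock.greatestHole G ≤ χ₁.α)
    (hα₂ : LayerClock.greatestHole G ≤ χ₂.α)
    (hK₁ : LayerClock.cyclomaticCharacteristic G < χ₁.K)
    (hK₂ : LayerClock.cyclomaticCharacteristic G < χ₂.K)
    {A : Type*} (app : LayerClock.Application G χ₁ χ₂ A) :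
    LayerClock.SelfStabilizing (LayerClock.Step ρ app) (LayerClock.WU G) := by
  refine ⟨LayerClock.closed_WU, fun e hmax _ => ?_⟩
  rcases hlast : e.last with _ | n
  -- The bound `2 ≤ C_G < K₁` supplies the `K₁ ≥ 3` needed for infinite executions.
  · have hK := LayerClock.two_le_cyclomaticCharacteristic (G := G)
    obtain ⟨t, ht⟩ := LayerClock.exists_WU_of_infinite hG (by omega) hα₁ hα₂ (s := e.state)
      fun t => e.step t (by rw [hlast]; exact ENat.natCast_lt_top t)
    exact ⟨t, le_top, ht⟩
  · exact ⟨n, le_rfl, LayerClock.WU_of_terminal (hmax n hlast)⟩
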